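/- **Setting.** Let $F$ be a finite field with $q$ elements. A discrete memoryless channel $W$ with input alphabet $F$ and finite output alphabet $\mathcal Y$ is *weakly symmetric* if $\mathcal Y$ has a finite partition $Y_1\cup\dots\cup Y_m$ such that for each $i$ the rows of the matrix $(W(y|x))_{x\in F,\,y\in Y_i}$ are permutations of each other, and so are its columns. For a uniformly distributed input $x$, let $\pi_y(a)=\mathrm{prob}(x=a\mid y)$ be the a posteriori probability vector and let $C_{KV}(W)=\mathbb E(\|\pi\|^2)$, with $\|\pi_y\|^2=\sum_{a\in F}\pi_y(a)^2$, be the Koetter–Vardy capacity of $W$. A Reed–Solomon code over $F$ of length $N$ and dimension $k$, $1\le k\le N$, is $\{(f(\alpha_1),\dots,f(\alpha_N)) : f\in F[X],\ \deg f<k\}$ with $\alpha_1,\dots,\alpha_N\in F$ distinct; its rate is $k/N$. The *Koetter–Vardy algorithm* with parameter $s\in\mathbb N$, applied to a received word $y\in\mathcal Y^N$ with reliability matrix $\Pi=(\pi_{y_j}(a))_{a\in F,\,1\le j\le N}$, does the following. 1. Starting from $M=0$, it increments $s$ times an entry $m_{a,j}$ of $M$ for which $\Pi_{a,j}/(m_{a,j}+1)$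 is largest. 2. It computes a nonzero polynomial $Q(X,Y)\in F[X,Y]$ of minimal $(1,k-1)$-weighted degree among those which have a zero of multiplicity at least $m_{a,j}$ at $(\alpha_j,a)$ for all $a,j$. 3. It outputs the list of all codewords $(f(\alpha_1),\dots,f(\alpha_N))$ with $\deg f<k$ and $Y-f(X)\mid Q(X,Y)$. It *decodes correctly* if the transmitted codeword is on this list, however ties in step 1 and the choice in step 2 are resolved. **Statement.** Let $(\mathcal C_n)_n$ be an infinite family of Reed–Solomon codes of rate $\le R$, whose lengths $N_n$ tend to infinity, over fields of size $q_n$, where $(q_n)$ is non-decreasing and tends to infinity. For each $n$ let $W_n$ be a weakly symmetric channel with input alphabet the field of $\mathcal C_n$, and assume that $C_{KV}(W_n)=\mathbb E(\|\pi_n\|^2)$ has a limit $C_{KV}^\infty$ as $n\to\infty$. If there is $\varepsilon>0$ with $$R\le C_{KV}^\infty-\varepsilon,$$ then the Koetter–Vardy algorithm decodes $\mathcal C_n$ on $W_n$ correctly with probability $1-o(1)$ when its parameter is large enough: there are integers $s_0(n)$ such that, for every choice of transmitted codewords $c_n\in\mathcal C_n$, the probability that the algorithm decodes correctly for all $s\ge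 s_0(n)$ tends to $1$ as $n\to\infty$. -/

import Mathlib

open Polynomial Filter Topology

noncomputable section

namespace KoetterVardy

/-- A discrete memoryless channel with input alphabet `X` and finite output alphabet `Y`:
`W.prob x y` is the probability of receiving `y` given that `x` was sent. -/
structure Channel (X Y : Type*) [Fintype Y] where
  prob : X → Y → ℝ
  nonneg : ∀ x y, 0 ≤ prob x y
  sum_eq_one : ∀ x, ∑ y, prob x y = 1

/-- All rows are permutations of each other, and all columns are permutations of each other. -/
def IsSymmetricMatrix {X Z : Type*} (A : Matrix X Z ℝ) : Prop :=
  (∀ x x' : X, ∃ σ : Equiv.Perm Z, ∀ z, A x z = A x' (σ z)) ∧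
  (∀ z z' : Z, ∃ τ : Equiv.Perm X, ∀ x, A x z = A (τ x) z')

/-- The output alphabet can be partitioned into finitely many blocks
`Y_i = {y | block y = i}` such that every submatrix `(W(y|x))_{x ∈ X, y ∈ Y_i}` is symmetric. -/
def Channel.WeaklySymmetric {X Y : Type*} [Fintype Y] (W : Channel X Y) : Prop :=
  ∃ (m : ℕ) (block : Y → Fin m), ∀ i : Fin m,
    IsSymmetricMatrix (Matrix.of fun (x : X) (y : {y : Y // block y = i}) => W.prob x y)

section Posterior

variable {X Y : Type*} [Fintype X] [Fintype Y]

/-- The probability of receiving `y` when the input is uniformly distributed. -/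
def Channel.outProb (W : Channel X Y) (y : Y) : ℝ :=
  ∑ x, (Fintype.card X : ℝ)⁻¹ * W.prob x y

/-- The a posteriori probability `π_y(a) = prob(x = a | y)`, for a uniformly distributed input. -/
def Channel.app (W : Channel X Y) (y : Y) (a : X) : ℝ :=
  (Fintype.card X : ℝ)⁻¹ * W.prob a y / W.outProb y

/-- The Koetter–Vardy capacity `E(‖π‖²)`, for a uniformly distributed input. -/
def Channel.kvCapacity (W : Channel X Y) : ℝ :=
  ∑ y, W.outProb y * ∑ a, W.app y a ^ 2

/-- The reliability matrix of a received word: its `j`-th column is the a posteriori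
probability vector of the `j`-th symbol. -/
def Channel.reliability (W : Channel X Y) {N : ℕ} (y : Fin N → Y) : Matrix X (Fin N) ℝ :=
  Matrix.of fun a j => W.app (y j) a

end Posterior

open Classical in
/-- The probability that the received word lies in `E` when the word `c` is sent and each symbol
goes through the channel independently. -/
def Channel.wordProb {X Y : Type*} [Fintype Y] (W : Channel X Y) {N : ℕ} (c : Fin N → X)
    (E : Set (Fin N → Y)) : ℝ :=
  ∑ y : Fin N → Y, if y ∈ E then ∏ j, W.prob (c j) (y j) else 0

section Decoder

variable {F : Type*} [Field F] {N : ℕ}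

/-- The Reed–Solomon code with evaluation points `α`: all words `(f(α₁), …, f(α_N))` with
`deg f < k`. -/
def rsCode (α : Fin N ↪ F) (k : ℕ) : Set (Fin N → F) :=
  {c | ∃ f : F[X], f.degree < k ∧ c = fun j => f.eval (α j)}

open Classical in
/-- Multiplicity assignment (greedy algorithm): `MultAssign P s M` says that `M` is a possible
outcome of the algorithm run on the reliability matrix `P` with `s` interpolation points. Starting
with the zero matrix, it increments, `s` times, an entry `(a, j)` of `M` for which
`P a j / (M a j + 1)` is largest; ties may be broken in any way. -/
inductive MultAssign (P : Matrix F (Fin N) ℝ) : ℕ → Matrix F (Fin N) ℕ → Prop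
  | zero : MultAssign P 0 0
  | step {s : ℕ} {M : Matrix F (Fin N) ℕ} (h : MultAssign P s M) (a : F) (j : Fin N)
      (hmax : ∀ b i, P b i / (M b i + 1 : ℝ) ≤ P a j / (M a j + 1 : ℝ)) :
      MultAssign P (s + 1) (M + Matrix.single a j 1)

/-- Bivariate polynomials are elements of `F[X][X]`: the outer variable is `Y`. The polynomial
`Q(X, Y)` has a zero of multiplicity at least `m` at `(x, a)`: no monomial of total degree less
than `m` occurs in `Q(X + x, Y + a)`. -/
def HasZeroMult (Q : F[X][X]) (x a : F) (m : ℕ) : Prop :=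
  ∀ i j : ℕ, i + j < m →
    (((Q.map (compRingHom (X + C x))).comp (X + C (C a))).coeff j).coeff i = 0

/-- The `(1, w)`-weighted degree: the maximum of `i + w j` over the monomials `Xⁱ Yʲ` of `Q`. -/
def weightedDeg (w : ℕ) (Q : F[X][X]) : ℕ :=
  Q.support.sup fun j => (Q.coeff j).natDegree + w * j

/-- `Q` is nonzero and meets the interpolation constraints given by `M`. -/
def Interpolates (α : Fin N ↪ F) (M : Matrix F (Fin N) ℕ) (Q : F[X][X]) : Prop :=
  Q ≠ 0 ∧ ∀ (a : F) (j : Fin N), HasZeroMult Q (α j) a (M a j)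

/-- Interpolation step: `Q` is an interpolating polynomial of minimal `(1, k-1)`-weighted degree. -/
def IsInterpolationPoly (α : Fin N ↪ F) (k : ℕ) (M : Matrix F (Fin N) ℕ) (Q : F[X][X]) : Prop :=
  Interpolates α M Q ∧ ∀ Q', Interpolates α M Q' → weightedDeg (k - 1) Q ≤ weightedDeg (k - 1) Q'

/-- Factorization step: the codewords which come from the factors `Y - f(X)` of `Q` with
`deg f < k`. -/
def factorList (α : Fin N ↪ F) (k : ℕ) (Q : F[X][X]) : Set (Fin N → F) :=
  {c | ∃ f : F[X], f.degree < k ∧ (X - C f) ∣ Q ∧ c = fun j => f.eval (α j)}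

/-- `Output α k P s ℓ`: the list `ℓ` is a possible output of the Koetter–Vardy algorithm for the
Reed–Solomon code `rsCode α k`, run on the reliability matrix `P` with parameter `s` (the total
number of interpolation points counted with multiplicity). The algorithm leaves open how to
break ties and which polynomial of minimal weighted degree to take. -/
def Output (α : Fin N ↪ F) (k : ℕ) (P : Matrix F (Fin N) ℝ) (s : ℕ) (ℓ : Set (Fin N → F)) : Prop :=
  ∃ M Q, MultAssign P s M ∧ IsInterpolationPoly α k M Q ∧ ℓ = factorList α k Q

/-- The algorithm puts `c` on its output list, however its choices are made. -/
def Succeeds (α : Fin N ↪ F) (k : ℕ) (P : Matrix F (Fin N) ℝ) (s : ℕ) (c : Fin N → F) : Prop :=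
  ∀ ℓ, Output α k P s ℓ → c ∈ ℓ

theorem exists_multAssign [Finite F] [NeZero N] (P : Matrix F (Fin N) ℝ) (s : ℕ) :
    ∃ M, MultAssign P s M := by
  induction s with
  | zero => exact ⟨0, .zero⟩
  | succ s ih =>
    obtain ⟨M, hM⟩ := ih
    obtain ⟨p, hp⟩ := Finite.exists_max
      (fun p : F × Fin N => P p.1 p.2 / (M p.1 p.2 + 1 : ℝ))
    exact ⟨_, .step hM p.1 p.2 fun b i => hp (b, i)⟩

theorem exists_interpolates [Finite F] (α : Fin N ↪ F) (M : Matrix F (Fin N) ℕ) :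
    ∃ Q, Interpolates α M Q := by
  have := Fintype.ofFinite F
  refine ⟨C (∏ j, (X - C (α j)) ^ (∑ a, M a j)), ?_, ?_⟩
  · rw [Ne, C_eq_zero]
    exact Finset.prod_ne_zero_iff.mpr fun j _ => pow_ne_zero _ (X_sub_C_ne_zero _)
  · intro a j i l hil
    simp only [map_C, C_comp, coeff_C]
    split_ifs
    · have hd : (X : F[X]) ^ (∑ a, M a j) ∣
          compRingHom (X + C (α j)) (∏ j, (X - C (α j)) ^ (∑ a, M a j)) := by
        rw [map_prod]
        refine dvd_trans ?_ (Finset.dvd_prod_of_mem _ (Finset.mem_univ j))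
        simp
      have hle : M a j ≤ ∑ a, M a j :=
        Finset.single_le_sum (f := fun a => M a j) (fun _ _ => Nat.zero_le _) (Finset.mem_univ a)
      exact X_pow_dvd_iff.mp hd i (by omega)
    · simp

/-- The algorithm always has an output, so that `Succeeds` is never vacuous. -/
theorem exists_output [Finite F] [NeZero N] (α : Fin N ↪ F) (k : ℕ) (P : Matrix F (Fin N) ℝ)
    (s : ℕ) : ∃ ℓ, Output α k P s ℓ := by
  obtain ⟨M, hM⟩ := exists_multAssign P s
  obtain ⟨Q₀, hQ₀⟩ := exists_interpolates α M
  obtain ⟨Q, hQ, hmin⟩ := WellFounded.has_min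
    (InvImage.wf (weightedDeg (k - 1)) (Nat.lt_wfRel.wf)) {Q | Interpolates α M Q} ⟨Q₀, hQ₀⟩
  exact ⟨_, M, Q, hM, ⟨hQ, fun Q' h => not_lt.mp (hmin Q' h)⟩, rfl⟩

end Decoder

end KoetterVardy

end

/-!
The proof has a probabilistic and a deterministic half, joined by the condition
`(k - 1) ∑ⱼ ‖π_{yⱼ}‖² < (∑ⱼ π_{yⱼ}(cⱼ))²` on the received word `y` and the sent word `c`.

*Probability.* For a weakly symmetric channel the output probability and `‖π_y‖²` are constant on
the blocks of outputs, and the rows are permutations of each other inside a block. Hence both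
`π_y(x)` and `‖π_y‖²` have mean exactly `C_KV(W)` given that `x` is sent, whatever `x` is
(`Channel.sum_prob_mul_app`, `Channel.sum_prob_mul_sum_app_sq`). Both variables lie in `[0, 1]`, so
by Chebyshev's inequality (`Channel.wordProb_deviation_mul_le`) the sums over `j` are within `δ N`
of `N C_KV(W)`, with probability `1 - O(1 / N)`. As `(k - 1) / N < C - ε`, where `C` is the limit
of the capacities, and `(C - ε) (C + 2δ) < (C - 2δ)²` for `δ = ε / 8`, the condition holds with
high probability.

*Decoding.* The greedy matrix `M` satisfies `T Π - 1 ≤ M ≤ T Π` entrywise for some real `T`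
(`MultAssign.exists_scale`), and `T → ∞` as `s → ∞`, because `s = ∑ M ≤ T ∑ Π`. Therefore, for
large `s`, the condition passes from `Π` to `M` in the form `(k - 1) ∑ m (m + 1) < S²`, where
`S = ∑ⱼ M (cⱼ, j)` (`MultAssign.eventually_lt_sq`). There are then more monomials of
`(1, k - 1)`-weighted degree less than `S` than there are interpolation constraints, and so the
interpolation polynomial `Q` has weighted degree less than `S` (`exists_interpolates_weightedDeg_lt`). If `f` is the message
polynomial, `Q(X, f(X))` has degree less than `S` but is divisible by
`∏ⱼ (X - αⱼ) ^ M (cⱼ, j)`, which has degree `S`. So it vanishes, and `Y - f(X)` divides `Q`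
(`X_sub_C_dvd_of_interpolates`). Since there are finitely many pairs `(y, c)` for each `n`, one
threshold for `s` serves them all.
-/

namespace KoetterVardy

/-! ### A posteriori probabilities of weakly symmetric channels -/

section Posterior

/-- Within a block the rows are permutations of each other, so a sum over the outputs of a
function of `W.prob x y` and of the block of `y` does not depend on `x`. -/
theorem sum_mul_eq_of_isSymmetricMatrix {A Y : Type*} [Fintype Y]
    {W : Channel A Y} {m : ℕ} {block : Y → Fin m}
    (hblock : ∀ i, IsSymmetricMatrix
      (Matrix.of fun (x : A) (y : {y : Y // block y = i}) => W.prob x y))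
    (φ : ℝ → ℝ) {h : Y → ℝ} (hh : ∀ y y', block y = block y' → h y = h y') (x x' : A) :
    ∑ y, φ (W.prob x y) * h y = ∑ y, φ (W.prob x' y) * h y := by
  rw [← Fintype.sum_fiberwise block, ← Fintype.sum_fiberwise block]
  refine Finset.sum_congr rfl fun i _ => ?_
  obtain ⟨σ, hσ⟩ := (hblock i).1 x x'
  rw [← Equiv.sum_comp σ fun z : {y : Y // block y = i} => φ (W.prob x' z) * h z]
  refine Finset.sum_congr rfl fun z _ => ?_
  have h1 : W.prob x z = W.prob x' (σ z) := hσ z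
  rw [h1, hh z (σ z) (z.2.trans (σ z).2.symm)]

variable {A Y : Type*} [Fintype A] [Fintype Y] (W : Channel A Y)

theorem Channel.outProb_nonneg (y : Y) : 0 ≤ W.outProb y :=
  Finset.sum_nonneg fun x _ => mul_nonneg (by positivity) (W.nonneg x y)

/-- This also holds if `y` is never received: then `W.app y a` is a division by zero, but
`W.prob a y` vanishes. -/
theorem Channel.outProb_mul_app (y : Y) (a : A) :
    W.outProb y * W.app y a = (Fintype.card A : ℝ)⁻¹ * W.prob a y := by
  unfold Channel.app
  by_cases h : W.outProb y = 0
  · have h0 := (Finset.sum_eq_zero_iff_of_nonneg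
      (fun x _ => mul_nonneg (by positivity) (W.nonneg x y))).mp h a (Finset.mem_univ a)
    rw [h0, h, zero_mul]
  · exact mul_div_cancel₀ _ h

theorem Channel.app_nonneg (y : Y) (a : A) : 0 ≤ W.app y a :=
  div_nonneg (mul_nonneg (by positivity) (W.nonneg a y)) (W.outProb_nonneg y)

theorem Channel.sum_app_le_one (y : Y) : ∑ a, W.app y a ≤ 1 := by
  simp only [Channel.app, ← Finset.sum_div]
  exact div_self_le_one _

theorem Channel.app_le_one (y : Y) (a : A) : W.app y a ≤ 1 :=
  (Finset.single_le_sum (fun b _ => W.app_nonneg y b) (Finset.mem_univ a)).trans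
    (W.sum_app_le_one y)

theorem Channel.sum_app_sq_le_one (y : Y) : ∑ a, W.app y a ^ 2 ≤ 1 :=
  (Finset.sum_le_sum fun a _ => pow_le_of_le_one (W.app_nonneg y a) (W.app_le_one y a)
    two_ne_zero).trans (W.sum_app_le_one y)

variable {W}

/-- Within a block the columns are permutations of each other, so a symmetric function of the
entries of a column depends only on its block. -/
theorem sum_eq_of_isSymmetricMatrix {m : ℕ} {block : Y → Fin m}
    (hblock : ∀ i, IsSymmetricMatrix
      (Matrix.of fun (x : A) (y : {y : Y // block y = i}) => W.prob x y))
    (φ : ℝ → ℝ) {y y' : Y} (hy : block y = block y') :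
    ∑ x, φ (W.prob x y) = ∑ x, φ (W.prob x y') := by
  obtain ⟨τ, hτ⟩ := (hblock (block y')).2 ⟨y, hy⟩ ⟨y', rfl⟩
  rw [← Equiv.sum_comp τ fun x => φ (W.prob x y')]
  exact Finset.sum_congr rfl fun x _ => congrArg φ (hτ x)

theorem eq_of_forall_eq_of_average {u : A → ℝ} {r : ℝ} (hu : ∀ x x', u x = u x')
    (hr : ∑ x, (Fintype.card A : ℝ)⁻¹ * u x = r) (x : A) : u x = r := by
  have : Nonempty A := ⟨x⟩
  rw [← hr, Finset.sum_congr rfl fun x' _ => by rw [hu x' x]]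
  simp

/-- Conditionally on the input `x`, the mean of `π_y(x)` is the Koetter–Vardy capacity. -/
theorem Channel.sum_prob_mul_app (hW : W.WeaklySymmetric) (x : A) :
    ∑ y, W.prob x y * W.app y x = W.kvCapacity := by
  obtain ⟨m, block, hblock⟩ := hW
  refine eq_of_forall_eq_of_average (u := fun x => ∑ y, W.prob x y * W.app y x) ?_ ?_ x
  · intro x x'
    have key := sum_mul_eq_of_isSymmetricMatrix hblock (fun t => t ^ 2)
      (h := fun y => (Fintype.card A : ℝ)⁻¹ / W.outProb y) (fun y y' hy => by
        simp only [Channel.outProb]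
        rw [sum_eq_of_isSymmetricMatrix hblock (fun t => (Fintype.card A : ℝ)⁻¹ * t) hy]) x x'
    convert key using 2 <;> (unfold Channel.app; ring)
  · simp only [Channel.kvCapacity, Finset.mul_sum]
    rw [Finset.sum_comm]
    refine Finset.sum_congr rfl fun y _ => Finset.sum_congr rfl fun a _ => ?_
    rw [← mul_assoc, ← W.outProb_mul_app]
    ring

/-- Conditionally on the input `x`, the mean of `‖π_y‖²` is the Koetter–Vardy capacity. -/
theorem Channel.sum_prob_mul_sum_app_sq (hW : W.WeaklySymmetric) (x : A) :
    ∑ y, W.prob x y * ∑ a, W.app y a ^ 2 = W.kvCapacity := by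
  obtain ⟨m, block, hblock⟩ := hW
  refine eq_of_forall_eq_of_average
    (u := fun x => ∑ y, W.prob x y * ∑ a, W.app y a ^ 2) ?_ ?_ x
  · refine sum_mul_eq_of_isSymmetricMatrix hblock (fun t => t) fun y y' hy => ?_
    have ho : W.outProb y = W.outProb y' :=
      sum_eq_of_isSymmetricMatrix hblock (fun t => (Fintype.card A : ℝ)⁻¹ * t) hy
    simp only [Channel.app]
    rw [ho]
    exact sum_eq_of_isSymmetricMatrix hblock
      (fun t => ((Fintype.card A : ℝ)⁻¹ * t / W.outProb y') ^ 2) hy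
  · simp only [Channel.kvCapacity, Channel.outProb, Finset.sum_mul, Finset.mul_sum
      (s := Finset.univ) (a := (Fintype.card A : ℝ)⁻¹), mul_assoc]
    exact Finset.sum_comm

end Posterior

/-! ### Chebyshev's inequality for memoryless channels -/

section Chebyshev

variable {A Y : Type*} [Fintype Y] (W : Channel A Y) {N : ℕ} (c : Fin N → A)

/-- Independence of the symbols: the mean of a product of functions of the single symbols is the
product of the means. -/
theorem Channel.sum_prod_mul_prod (h : Fin N → Y → ℝ) :
    ∑ y : Fin N → Y, (∏ j, W.prob (c j) (y j)) * ∏ j, h j (y j) =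
      ∏ j, ∑ z, W.prob (c j) z * h j z := by
  classical
  simp only [Finset.prod_univ_sum, Fintype.piFinset_univ, Finset.prod_mul_distrib]

theorem Channel.sum_prod_prob : ∑ y : Fin N → Y, ∏ j, W.prob (c j) (y j) = 1 := by
  simpa [W.sum_eq_one] using W.sum_prod_mul_prod c fun _ _ => 1

theorem Channel.wordProb_le_one (E : Set (Fin N → Y)) : W.wordProb c E ≤ 1 := by
  rw [← W.sum_prod_prob c]
  refine Finset.sum_le_sum fun y _ => ?_
  split_ifs
  · exact le_rfl
  · exact Finset.prod_nonneg fun j _ => W.nonneg _ _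

theorem Channel.one_le_wordProb_add_add {E E₁ E₂ : Set (Fin N → Y)}
    (h : ∀ y, y ∉ E₁ → y ∉ E₂ → y ∈ E) :
    1 ≤ W.wordProb c E + W.wordProb c E₁ + W.wordProb c E₂ := by
  simp only [Channel.wordProb, ← Finset.sum_add_distrib]
  rw [← W.sum_prod_prob c]
  refine Finset.sum_le_sum fun y _ => ?_
  have h0 : 0 ≤ ∏ j, W.prob (c j) (y j) := Finset.prod_nonneg fun j _ => W.nonneg _ _
  have := h y
  split_ifs <;> first | linarith | tauto

/-- The variance of a sum of independent centred variables is the sum of the variances. -/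
theorem Channel.sum_prod_mul_sq_sum {g : Fin N → Y → ℝ}
    (hg : ∀ j, ∑ z, W.prob (c j) z * g j z = 0) :
    ∑ y : Fin N → Y, (∏ j, W.prob (c j) (y j)) * (∑ j, g j (y j)) ^ 2 =
      ∑ j, ∑ z, W.prob (c j) z * g j z ^ 2 := by
  have hcov : ∀ i k, ∑ y : Fin N → Y, (∏ j, W.prob (c j) (y j)) * (g i (y i) * g k (y k)) =
      if i = k then ∑ z, W.prob (c i) z * g i z ^ 2 else 0 := by
    intro i k
    have key := W.sum_prod_mul_prod c fun j z =>
      (if j = i then g j z else 1) * (if j = k then g j z else 1)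
    simp only [Finset.prod_mul_distrib, Finset.prod_ite_eq', Finset.mem_univ, if_true] at key
    rw [key]
    split_ifs with hik
    · subst hik
      rw [Finset.prod_eq_single i]
      · simp [sq]
      · intro j _ hj
        simp [hj, W.sum_eq_one]
      · simp
    · refine Finset.prod_eq_zero (Finset.mem_univ i) ?_
      simpa [hik] using hg i
  simp only [sq (∑ j, _), Finset.sum_mul_sum]
  simp only [Finset.mul_sum]
  rw [Finset.sum_comm]
  refine Finset.sum_congr rfl fun i _ => ?_
  rw [Finset.sum_comm]
  simp only [hcov]
  simp

/-- Chebyshev's inequality, for independent variables with values in `[0, 1]` and mean `μ`. -/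
theorem Channel.wordProb_deviation_mul_le {g : Fin N → Y → ℝ} (hg0 : ∀ j z, 0 ≤ g j z)
    (hg1 : ∀ j z, g j z ≤ 1) {μ : ℝ} (hμ : ∀ j, ∑ z, W.prob (c j) z * g j z = μ)
    {δ : ℝ} (hδ : 0 ≤ δ) :
    W.wordProb c {y | δ * N ≤ |∑ j, g j (y j) - N * μ|} * (δ * N) ^ 2 ≤ N := by
  have hcent : ∀ j, ∑ z, W.prob (c j) z * (g j z - μ) = 0 := by
    intro j
    simp only [mul_sub, Finset.sum_sub_distrib, ← Finset.sum_mul]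
    rw [hμ, W.sum_eq_one]
    ring
  calc W.wordProb c {y | δ * N ≤ |∑ j, g j (y j) - N * μ|} * (δ * N) ^ 2
      ≤ ∑ y : Fin N → Y, (∏ j, W.prob (c j) (y j)) * (∑ j, (g j (y j) - μ)) ^ 2 := by
        rw [Channel.wordProb, Finset.sum_mul]
        refine Finset.sum_le_sum fun y _ => ?_
        have h0 : 0 ≤ ∏ j, W.prob (c j) (y j) := Finset.prod_nonneg fun j _ => W.nonneg _ _
        split_ifs with hy
        · refine mul_le_mul_of_nonneg_left ?_ h0
          have hsum : ∑ j, (g j (y j) - μ) = ∑ j, g j (y j) - N * μ := by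
            simp [Finset.sum_sub_distrib]
          rw [hsum, ← sq_abs (∑ j, g j (y j) - N * μ)]
          exact pow_le_pow_left₀ (by positivity) hy 2
        · rw [zero_mul]
          positivity
    _ = ∑ j, ∑ z, W.prob (c j) z * (g j z - μ) ^ 2 := W.sum_prod_mul_sq_sum c hcent
    _ ≤ ∑ _j : Fin N, (1 : ℝ) := by
        refine Finset.sum_le_sum fun j _ => ?_
        have hμ0 : 0 ≤ μ := by
          rw [← hμ j]
          exact Finset.sum_nonneg fun z _ => mul_nonneg (W.nonneg _ _) (hg0 j z)
        have hμ1 : μ ≤ 1 := by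
          rw [← hμ j, ← W.sum_eq_one (c j)]
          exact Finset.sum_le_sum fun z _ => mul_le_of_le_one_right (W.nonneg _ _) (hg1 j z)
        rw [← W.sum_eq_one (c j)]
        refine Finset.sum_le_sum fun z _ => mul_le_of_le_one_right (W.nonneg _ _) ?_
        rw [sq_le_one_iff_abs_le_one, abs_le]
        constructor <;> linarith [hg0 j z, hg1 j z]
    _ = N := by simp

end Chebyshev

/-! ### The greedy multiplicity assignment -/

section Greedy

variable {F : Type*} {N : ℕ} {P : Matrix F (Fin N) ℝ} {s : ℕ} {M : Matrix F (Fin N) ℕ}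

theorem MultAssign.sum_eq [Fintype F] (h : MultAssign P s M) : ∑ a, ∑ j, M a j = s := by
  classical
  induction h with
  | zero => simp
  | step h a j hmax ih =>
    simp only [Matrix.add_apply, Finset.sum_add_distrib, ih, Matrix.single_apply]
    congr 1
    rw [Finset.sum_eq_single a, Finset.sum_eq_single j] <;> simp +contextual [eq_comm]

/-- An entry that has been incremented was maximal when this last happened, and quotients only
decrease afterwards. -/
theorem MultAssign.div_le_div (hP : ∀ a j, 0 ≤ P a j) (h : MultAssign P s M) {a : F} {j : Fin N}
    (haj : 0 < M a j) (b : F) (i : Fin N) : P b i / (M b i + 1 : ℝ) ≤ P a j / (M a j : ℝ) := by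
  classical
  induction h with
  | zero => simp at haj
  | @step s M h a₀ j₀ hmax ih =>
    have hdec : P b i / (((M + Matrix.single a₀ j₀ 1 : Matrix F (Fin N) ℕ) b i : ℕ) + 1 : ℝ) ≤
        P b i / (M b i + 1 : ℝ) := by
      refine div_le_div_of_nonneg_left (hP b i) (by positivity) ?_
      simp only [Matrix.add_apply, Nat.cast_add]
      linarith [Nat.cast_nonneg (α := ℝ) ((Matrix.single a₀ j₀ 1 : Matrix F (Fin N) ℕ) b i)]
    refine hdec.trans ?_
    by_cases hpos : a₀ = a ∧ j₀ = j
    · obtain ⟨rfl, rfl⟩ := hpos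
      simpa [Matrix.add_apply, Matrix.single_apply] using hmax b i
    · simp only [Matrix.add_apply, Matrix.single_apply, hpos, if_false, add_zero] at haj ⊢
      exact ih haj

/-- The greedy algorithm rounds a multiple `T • P` of the reliability matrix. The factor `T` is
the inverse of the largest quotient `P a j / (M a j + 1)`. -/
theorem MultAssign.exists_scale [Finite F] (hP : ∀ a j, 0 ≤ P a j) {a₀ : F} {j₀ : Fin N}
    (h₀ : 0 < P a₀ j₀) (h : MultAssign P s M) :
    ∃ T : ℝ, 0 < T ∧ ∀ a j, (M a j : ℝ) ≤ T * P a j ∧ T * P a j ≤ M a j + 1 := by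
  have : Nonempty (F × Fin N) := ⟨(a₀, j₀)⟩
  obtain ⟨⟨b, i⟩, hmax⟩ := Finite.exists_max
    (fun p : F × Fin N => P p.1 p.2 / (M p.1 p.2 + 1 : ℝ))
  set r : ℝ := P b i / (M b i + 1 : ℝ) with hr
  have hr0 : 0 < r := (div_pos h₀ (by positivity)).trans_le (hmax (a₀, j₀))
  refine ⟨r⁻¹, inv_pos.mpr hr0, fun a j => ⟨?_, ?_⟩⟩
  · rw [inv_mul_eq_div, le_div_iff₀ hr0]
    rcases Nat.eq_zero_or_pos (M a j) with h0 | h0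
    · simpa [h0] using hP a j
    · have := h.div_le_div hP h0 b i
      rwa [← hr, le_div_iff₀ (by exact_mod_cast h0), mul_comm] at this
  · rw [inv_mul_eq_div, div_le_iff₀ hr0]
    have := hmax (a, j)
    rwa [div_le_iff₀ (by positivity), mul_comm] at this

/-- For large `s`, a strict inequality for the reliability matrix passes to the multiplicities. -/
theorem MultAssign.eventually_lt_sq [Fintype F] (hP : ∀ a j, 0 ≤ P a j) (c : Fin N → F) (w : ℕ)
    (hpos : 0 < ∑ j, P (c j) j)
    (hlt : w * ∑ j, ∑ a, P a j ^ 2 < (∑ j, P (c j) j) ^ 2) :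
    ∀ᶠ s : ℕ in atTop, ∀ M, MultAssign P s M →
      0 < ∑ j, M (c j) j ∧ w * ∑ j, ∑ a, M a j * (M a j + 1) < (∑ j, M (c j) j) ^ 2 := by
  set A := ∑ j, P (c j) j with hA
  set B := ∑ j, ∑ a, P a j ^ 2 with hB
  set U := ∑ j, ∑ a, P a j with hU
  have hAU : A ≤ U := Finset.sum_le_sum fun j _ =>
    Finset.single_le_sum (f := fun a => P a j) (fun a _ => hP a j) (Finset.mem_univ (c j))
  have hU0 : 0 < U := hpos.trans_le hAU
  have hD : 0 < A ^ 2 - w * B := by linarith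
  obtain ⟨j₀, -, h₀⟩ := Finset.exists_lt_of_sum_lt (s := Finset.univ) (f := fun _ => (0 : ℝ))
    (g := fun j => P (c j) j) (by simpa using hpos)
  -- If `T` exceeds this bound, then `0 < T A - N` and `w (T² B + T U) < (T A - N)²`.
  set T₀ : ℝ := N / A + (2 * A * N + w * U) / (A ^ 2 - w * B) with hT₀
  filter_upwards [tendsto_natCast_atTop_atTop.eventually_gt_atTop (T₀ * U)] with s hs M hM
  obtain ⟨T, hT, hTM⟩ := hM.exists_scale hP h₀
  have hsT : (s : ℝ) ≤ T * U := by
    rw [← hM.sum_eq, hU, Finset.sum_comm (f := fun j a => P a j)]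
    push_cast
    simp only [Finset.mul_sum]
    exact Finset.sum_le_sum fun a _ => Finset.sum_le_sum fun j _ => (hTM a j).1
  have hTT : T₀ < T := lt_of_mul_lt_mul_right (hs.trans_le hsT) hU0.le
  have hT1 : N / A < T := by
    have : 0 ≤ (2 * A * N + w * U) / (A ^ 2 - w * B) := by positivity
    linarith
  have hT2 : (2 * A * N + w * U) / (A ^ 2 - w * B) < T := by
    have : 0 ≤ N / A := by positivity
    linarith
  rw [div_lt_iff₀ hpos] at hT1
  rw [div_lt_iff₀ hD] at hT2
  have hS : T * A - N ≤ ∑ j, (M (c j) j : ℝ) := by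
    have : T * A ≤ ∑ j, ((M (c j) j : ℝ) + 1) := by
      rw [hA, Finset.mul_sum]
      exact Finset.sum_le_sum fun j _ => (hTM _ j).2
    simp only [Finset.sum_add_distrib, Finset.sum_const, Finset.card_univ, Fintype.card_fin,
      nsmul_eq_mul, mul_one] at this
    linarith
  have hC : ∑ j, ∑ a, (M a j : ℝ) * (M a j + 1) ≤ T ^ 2 * B + T * U := by
    simp only [hB, hU, Finset.mul_sum, ← Finset.sum_add_distrib]
    refine Finset.sum_le_sum fun j _ => Finset.sum_le_sum fun a _ => ?_
    have h1 := (hTM a j).1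
    have h2 : (0 : ℝ) ≤ M a j := by positivity
    nlinarith
  constructor
  · have : (0 : ℝ) < ∑ j, (M (c j) j : ℝ) := by linarith
    exact_mod_cast this
  · have : (w : ℝ) * ∑ j, ∑ a, (M a j : ℝ) * (M a j + 1) < (∑ j, (M (c j) j : ℝ)) ^ 2 := by
      calc (w : ℝ) * ∑ j, ∑ a, (M a j : ℝ) * (M a j + 1) ≤ w * (T ^ 2 * B + T * U) := by gcongr
        _ < (T * A - N) ^ 2 := by
          have := mul_lt_mul_of_pos_left hT2 hT
          nlinarith [sq_nonneg (N : ℝ)]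
        _ ≤ _ := pow_le_pow_left₀ (by linarith) hS 2
    exact_mod_cast this

end Greedy

/-! ### Interpolation polynomials of small weighted degree -/

section Interpolation

variable {F : Type*} [Field F] {N : ℕ}

/-- The number of pairs `(u, v)` with `u + v < m` is `m (m + 1) / 2`. -/
theorem two_mul_sum_fin_sub (m : ℕ) : 2 * ∑ u : Fin m, (m - (u : ℕ)) = m * (m + 1) := by
  rw [Fin.sum_univ_eq_sum_range fun u => m - u]
  induction m with
  | zero => simp
  | succ m ih =>
    rw [Finset.sum_range_succ']
    simp only [Nat.add_sub_add_right, mul_add, ih]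
    simp only [Nat.sub_zero]
    ring

/-- The area under the line `t ↦ S - w t` is at most its left Riemann sum. -/
theorem sq_le_sum_sub_add_sq (S w J : ℕ) :
    S ^ 2 ≤ 2 * w * ∑ j ∈ Finset.range J, (S - w * j) + (S - w * J) ^ 2 := by
  induction J with
  | zero => simp
  | succ J ih =>
    refine ih.trans ?_
    rw [Finset.sum_range_succ, mul_add, add_assoc, mul_add w J, mul_one, ← Nat.sub_sub]
    gcongr
    generalize S - w * J = r
    rcases le_total w r with h | h
    · obtain ⟨t, rfl⟩ := Nat.exists_eq_add_of_le h
      rw [Nat.add_sub_cancel_left]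
      nlinarith [Nat.zero_le (w * t), Nat.zero_le (w * w)]
    · nlinarith [Nat.zero_le ((r - w) ^ 2), Nat.mul_le_mul_right r h]

/-- There are more monomials of weighted degree less than `S` than constraints. For `w = 0` the
degree in `Y` is not bounded by the weighted degree and any number of monomials is available. -/
theorem exists_lt_sum_sub {S w K : ℕ} (hS : 0 < S) (h : w * (2 * K) < S ^ 2) :
    ∃ J, K < ∑ j : Fin J, (S - w * (j : ℕ)) := by
  rcases Nat.eq_zero_or_pos w with rfl | hw
  · refine ⟨K + 1, ?_⟩
    simp only [zero_mul, Nat.sub_zero, Finset.sum_const, Finset.card_univ, Fintype.card_fin,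
      smul_eq_mul]
    nlinarith
  · refine ⟨S, ?_⟩
    rw [Fin.sum_univ_eq_sum_range fun j => S - w * j]
    have h1 := sq_le_sum_sub_add_sq S w S
    rw [Nat.sub_eq_zero_of_le (Nat.le_mul_of_pos_left S hw)] at h1
    have h2 : 2 * w * K < 2 * w * ∑ j ∈ Finset.range S, (S - w * j) := by nlinarith
    exact lt_of_mul_lt_mul_left h2 (Nat.zero_le _)

/-- The coefficient of `Xⁱ Yʲ` in `Q(X + x, Y + a)`, as a linear function of `Q`. -/
noncomputable def shiftCoeff (x a : F) (i j : ℕ) : F[X][X] →ₗ[F] F where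
  toFun Q := (((Q.map (compRingHom (X + C x))).comp (X + C (C a))).coeff j).coeff i
  map_add' Q Q' := by simp
  map_smul' r Q := by
    have : r • Q = C (C r) * Q := by
      ext
      simp
    simp [this]

/-- The bivariate polynomial with coefficient `v ⟨j, i⟩` at `Xⁱ Yʲ`, for `j < J` and `i < d j`,
and no other monomials. -/
noncomputable def ofCoeffs {J : ℕ} (d : Fin J → ℕ) :
    ((Σ j : Fin J, Fin (d j)) → F) →ₗ[F] F[X][X] :=
  Fintype.linearCombination F fun p => monomial (p.1 : ℕ) (monomial (p.2 : ℕ) (1 : F))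

theorem coeff_coeff_ofCoeffs {J : ℕ} (d : Fin J → ℕ) (v : (Σ j : Fin J, Fin (d j)) → F)
    (j i : ℕ) : ((ofCoeffs d v).coeff j).coeff i =
      ∑ p : Σ j : Fin J, Fin (d j), if (p.1 : ℕ) = j ∧ (p.2 : ℕ) = i then v p else 0 := by
  simp only [ofCoeffs, Fintype.linearCombination_apply, finsetSum_coeff, coeff_smul,
    coeff_monomial]
  refine Finset.sum_congr rfl fun p _ => ?_
  by_cases h1 : (p.1 : ℕ) = j <;> by_cases h2 : (p.2 : ℕ) = i <;> simp [h1, h2, coeff_monomial]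

theorem coeff_coeff_ofCoeffs_self {J : ℕ} (d : Fin J → ℕ) (v : (Σ j : Fin J, Fin (d j)) → F)
    (p : Σ j : Fin J, Fin (d j)) : ((ofCoeffs d v).coeff p.1).coeff p.2 = v p := by
  rw [coeff_coeff_ofCoeffs, Finset.sum_eq_single p]
  · simp
  · rintro ⟨j, i⟩ - hne
    obtain ⟨j', i'⟩ := p
    rw [if_neg]
    rintro ⟨h1, h2⟩
    obtain rfl : j = j' := Fin.ext h1
    obtain rfl : i = i' := Fin.ext h2
    exact hne rfl
  · simp

theorem weightedDeg_ofCoeffs_lt {J S w : ℕ} (hS : 0 < S)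
    (v : (Σ j : Fin J, Fin (S - w * (j : ℕ))) → F) :
    weightedDeg w (ofCoeffs (fun j : Fin J => S - w * (j : ℕ)) v) < S := by
  rw [weightedDeg, Finset.sup_lt_iff (by simpa using hS)]
  intro j hj
  have hne := leadingCoeff_ne_zero.mpr (mem_support_iff.mp hj)
  rw [leadingCoeff, coeff_coeff_ofCoeffs] at hne
  obtain ⟨p, -, hp⟩ := Finset.exists_ne_zero_of_sum_ne_zero hne
  obtain ⟨⟨h1, h2⟩, -⟩ := ite_ne_right_iff.mp hp
  have hlt := p.2.isLt
  have hp1 : w * (p.1 : ℕ) = w * j := by rw [h1]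
  omega

/-- Linear algebra: with more monomials than constraints there is a nonzero solution. -/
theorem exists_interpolates_weightedDeg_lt [Fintype F] (α : Fin N ↪ F) (M : Matrix F (Fin N) ℕ)
    {w S : ℕ} (hS : 0 < S) (h : w * ∑ j, ∑ a, M a j * (M a j + 1) < S ^ 2) :
    ∃ Q, Interpolates α M Q ∧ weightedDeg w Q < S := by
  have hcount : ∑ j, ∑ a, M a j * (M a j + 1) =
      2 * ∑ j, ∑ a, ∑ u : Fin (M a j), (M a j - (u : ℕ)) := by
    simp only [Finset.mul_sum (s := Finset.univ) (a := 2), ← two_mul_sum_fin_sub]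
  rw [hcount] at h
  obtain ⟨J, hJ⟩ := exists_lt_sum_sub hS h
  let L : ((Σ j : Fin J, Fin (S - w * (j : ℕ))) → F) →ₗ[F]
      ((Σ j : Fin N, Σ a : F, Σ u : Fin (M a j), Fin (M a j - (u : ℕ))) → F) :=
    (LinearMap.pi fun q => shiftCoeff (α q.1) q.2.1 q.2.2.1 q.2.2.2) ∘ₗ ofCoeffs _
  have hker : LinearMap.ker L ≠ ⊥ := by
    apply LinearMap.ker_ne_bot_of_finrank_lt
    simpa [Module.finrank_fintype_fun_eq_card, Fintype.card_sigma] using hJ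
  obtain ⟨v, hv, hv0⟩ := Submodule.exists_mem_ne_zero_of_ne_bot hker
  refine ⟨ofCoeffs _ v, ⟨fun h0 => hv0 (funext fun p => ?_), fun a j i l hil => ?_⟩,
    weightedDeg_ofCoeffs_lt hS v⟩
  · rw [← coeff_coeff_ofCoeffs_self _ v p, h0]
    simp
  · exact congrFun (LinearMap.mem_ker.mp hv) ⟨j, a, ⟨i, by omega⟩, ⟨l, by simp; omega⟩⟩

end Interpolation

/-! ### Factors of the interpolation polynomial -/

section Factorization

variable {F : Type*} [Field F] {N : ℕ}

/-- A zero of multiplicity `m` at a point of the graph of `f` is a zero of multiplicity `m` of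
`Q(X, f(X))`. -/
theorem HasZeroMult.pow_dvd_eval {Q : F[X][X]} {x a : F} {m : ℕ} (h : HasZeroMult Q x a m)
    {f : F[X]} (hf : f.eval x = a) : (X - C x) ^ m ∣ Q.eval f := by
  set Q' := (Q.map (compRingHom (X + C x))).comp (X + C (C a)) with hQ'
  have heval : Q'.eval (f.comp (X + C x) - C a) = (Q.eval f).comp (X + C x) := by
    rw [hQ', eval_comp]
    simp only [eval_add, eval_X, eval_C, sub_add_cancel]
    exact eval_map_apply (f := compRingHom (X + C x)) f
  have hX : X ∣ f.comp (X + C x) - C a := by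
    rw [X_dvd_iff, coeff_zero_eq_eval_zero]
    simp [eval_comp, hf]
  have hdvd : X ^ m ∣ (Q.eval f).comp (X + C x) := by
    rw [← heval, eval_eq_sum, Polynomial.sum]
    refine Finset.dvd_sum fun j _ => ?_
    have h1 : X ^ (m - j) ∣ Q'.coeff j := X_pow_dvd_iff.mpr fun i hi => h i j (by omega)
    have h2 : (X : F[X]) ^ m ∣ X ^ (m - j) * X ^ j := by
      rw [← pow_add]
      exact pow_dvd_pow X (by omega)
    exact h2.trans (mul_dvd_mul h1 (pow_dvd_pow_of_dvd hX j))
  have := _root_.map_dvd (compRingHom (X - C x)) hdvd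
  simpa [comp_assoc] using this

theorem natDegree_eval_le_weightedDeg {w : ℕ} (Q : F[X][X]) {f : F[X]} (hf : f.natDegree ≤ w) :
    (Q.eval f).natDegree ≤ weightedDeg w Q := by
  rw [eval_eq_sum, Polynomial.sum]
  refine natDegree_sum_le_of_forall_le _ _ fun j hj => ?_
  calc (Q.coeff j * f ^ j).natDegree ≤ (Q.coeff j).natDegree + j * f.natDegree :=
        natDegree_mul_le.trans (Nat.add_le_add_left natDegree_pow_le _)
    _ ≤ (Q.coeff j).natDegree + w * j := by
        rw [mul_comm j]
        gcongr
    _ ≤ weightedDeg w Q :=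
        Finset.le_sup (f := fun j => (Q.coeff j).natDegree + w * j) hj

/-- `Q(X, f(X))` has more zeros, counted with multiplicity, than its degree allows. -/
theorem X_sub_C_dvd_of_interpolates {α : Fin N ↪ F} {M : Matrix F (Fin N) ℕ} {Q : F[X][X]}
    (hQ : Interpolates α M Q) {w : ℕ} {f : F[X]} (hf : f.natDegree ≤ w)
    (hdeg : weightedDeg w Q < ∑ j, M (f.eval (α j)) j) : X - C f ∣ Q := by
  rw [dvd_iff_isRoot, IsRoot]
  have hdvd : ∏ j, (X - C (α j)) ^ M (f.eval (α j)) j ∣ Q.eval f :=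
    Finset.prod_dvd_of_coprime
      (fun i _ j _ hij => (pairwise_coprime_X_sub_C α.injective hij).pow)
      fun j _ => (hQ.2 _ j).pow_dvd_eval rfl
  refine eq_zero_of_dvd_of_natDegree_lt hdvd ?_
  rw [natDegree_prod_of_monic _ _ fun j _ => (monic_X_sub_C _).pow _]
  simpa using (natDegree_eval_le_weightedDeg Q hf).trans_lt hdeg

/-- If the multiplicities along the graph of the codeword outweigh the number of constraints, for
every outcome of the greedy algorithm, then the codeword is on the list. -/
theorem succeeds_of_lt_sq [Fintype F] {α : Fin N ↪ F} {k : ℕ} {P : Matrix F (Fin N) ℝ} {s : ℕ}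
    {c : Fin N → F} (hc : c ∈ rsCode α k)
    (h : ∀ M, MultAssign P s M → 0 < ∑ j, M (c j) j ∧
      (k - 1) * ∑ j, ∑ a, M a j * (M a j + 1) < (∑ j, M (c j) j) ^ 2) :
    Succeeds α k P s c := by
  rintro _ ⟨M, Q, hM, ⟨hQ, hmin⟩, rfl⟩
  obtain ⟨f, hf, rfl⟩ := hc
  obtain ⟨hS, hlt⟩ := h M hM
  obtain ⟨Q', hQ', hdeg⟩ := exists_interpolates_weightedDeg_lt α M hS hlt
  have hfk : f.natDegree ≤ k - 1 := by
    rcases eq_or_ne f 0 with rfl | hf0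
    · simp
    · exact Nat.le_sub_one_of_lt ((natDegree_lt_iff_degree_lt hf0).mpr hf)
  exact ⟨f, hf, X_sub_C_dvd_of_interpolates hQ hfk ((hmin Q' hQ').trans_lt hdeg), rfl⟩

/-- The threshold for `s` is uniform in the received and the transmitted word, as there are
finitely many of both. -/
theorem exists_forall_succeeds [Fintype F] {Y : Type*} [Fintype Y] (W : Channel F Y)
    (α : Fin N ↪ F) (k : ℕ) :
    ∃ s₀ : ℕ, ∀ (c : Fin N → F) (y : Fin N → Y), c ∈ rsCode α k →
      0 < ∑ j, W.app (y j) (c j) →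
      (k - 1 : ℕ) * ∑ j, ∑ a, W.app (y j) a ^ 2 < (∑ j, W.app (y j) (c j)) ^ 2 →
      ∀ s, s₀ ≤ s → Succeeds α k (W.reliability y) s c := by
  have : ∀ᶠ s : ℕ in atTop, ∀ (c : Fin N → F) (y : Fin N → Y), c ∈ rsCode α k →
      0 < ∑ j, W.app (y j) (c j) →
      (k - 1 : ℕ) * ∑ j, ∑ a, W.app (y j) a ^ 2 < (∑ j, W.app (y j) (c j)) ^ 2 →
      Succeeds α k (W.reliability y) s c := by
    simp only [eventually_all]
    intro c y hc hpos hlt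
    filter_upwards [MultAssign.eventually_lt_sq (P := W.reliability y)
      (fun a j => W.app_nonneg (y j) a) c (k - 1) hpos hlt] with s hs
    exact succeeds_of_lt_sq hc hs
  obtain ⟨s₀, hs₀⟩ := eventually_atTop.mp this
  exact ⟨s₀, fun c y hc hpos hlt s hs => hs₀ s hs c y hc hpos hlt⟩

end Factorization

/-! ### Decoding below the capacity -/

/-- For `δ = ε / 8`, sums within `δ N` of their common mean `N C'` satisfy the decoding
condition. -/
theorem decoding_condition {C C' R ε n w S Z : ℝ} (hn : 0 < n) (hw0 : 0 ≤ w) (hε : 0 < ε)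
    (hw : w < R * n) (hR : R ≤ C - ε) (hC : |C' - C| < ε / 8)
    (hS : |S - n * C'| < ε / 8 * n) (hZ : |Z - n * C'| < ε / 8 * n) :
    0 < S ∧ w * Z < S ^ 2 := by
  rw [abs_lt] at hC hS hZ
  have hR0 : 0 < R := pos_of_mul_pos_left (hw0.trans_lt hw) hn.le
  have hCn : |C' - C| * n < ε / 8 * n := by
    refine mul_lt_mul_of_pos_right (abs_lt.mpr hC) hn
  have h1 : n * (C - ε / 4) < S := by nlinarith
  have h2 : Z < n * (C + ε / 4) := by nlinarith
  have h3 : 0 < n * (C - ε / 4) := mul_pos hn (by linarith)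
  refine ⟨h3.trans h1, ?_⟩
  have hCpos : 0 < C + ε / 4 := by linarith
  calc w * Z ≤ w * (n * (C + ε / 4)) := by gcongr
    _ ≤ R * n * (n * (C + ε / 4)) := by gcongr
    _ ≤ (C - ε) * n * (n * (C + ε / 4)) := by gcongr
    _ ≤ (n * (C - ε / 4)) ^ 2 := by
        have : 0 ≤ n ^ 2 * (ε * (C / 4 + 5 * ε / 16)) := by
          have : 0 < C := by linarith
          positivity
        nlinarith
    _ < S ^ 2 := pow_lt_pow_left₀ h1 h3.le two_ne_zero

end KoetterVardy

theorem mainTheorem6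
    -- the alphabets, and the Reed-Solomon codes: lengths, dimensions, evaluation points
    (F : ℕ → Type*) [∀ n, Field (F n)] [∀ n, Fintype (F n)]
    (N k : ℕ → ℕ) (α : ∀ n, Fin (N n) ↪ F n)
    (hk : ∀ n, 1 ≤ k n) (hkN : ∀ n, k n ≤ N n)
    (hN : Tendsto N atTop atTop)
    (hq_mono : Monotone fun n => Fintype.card (F n))
    (hq : Tendsto (fun n => Fintype.card (F n)) atTop atTop)
    -- the channels
    (Y : ℕ → Type*) [∀ n, Fintype (Y n)]
    (W : ∀ n, KoetterVardy.Channel (F n) (Y n))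
    (hW : ∀ n, (W n).WeaklySymmetric)
    (Cinf : ℝ) (hC : Tendsto (fun n => (W n).kvCapacity) atTop (𝓝 Cinf))
    -- the rates
    (R ε : ℝ) (hrate : ∀ n, (k n : ℝ) / (N n : ℝ) ≤ R) (hε : 0 < ε) (hR : R ≤ Cinf - ε) :
    ∃ s₀ : ℕ → ℕ, ∀ c : ∀ n, Fin (N n) → F n,
      (∀ n, c n ∈ KoetterVardy.rsCode (α n) (k n)) →
      Tendsto
        (fun n => (W n).wordProb (c n)
          {y | ∀ s, s₀ n ≤ s →
            KoetterVardy.Succeeds (α n) (k n) ((W n).reliability y) s (c n)})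
        atTop (𝓝 1) := by
  choose s₀ hs₀ using fun n =>
    KoetterVardy.exists_forall_succeeds (W n) (α n) (k n)
  refine ⟨s₀, fun c hc => ?_⟩
  have hlim : Tendsto (fun n => 1 - 2 * ((ε / 8) ^ 2 * (N n : ℝ))⁻¹) atTop (𝓝 1) := by
    have h1 : Tendsto (fun n => (ε / 8) ^ 2 * (N n : ℝ)) atTop atTop :=
      (tendsto_natCast_atTop_atTop.comp hN).const_mul_atTop (by positivity)
    simpa using (h1.inv_tendsto_atTop.const_mul 2).const_sub 1
  refine tendsto_of_tendsto_of_tendsto_of_le_of_le' hlim tendsto_const_nhds ?_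
    (Eventually.of_forall fun n => (W n).wordProb_le_one _ _)
  filter_upwards [Metric.tendsto_nhds.mp hC (ε / 8) (by positivity)] with n hCn
  have hNpos : (0 : ℝ) < N n := by exact_mod_cast (hk n).trans (hkN n)
  have hdev : ∀ g : Fin (N n) → Y n → ℝ, (∀ j z, 0 ≤ g j z) → (∀ j z, g j z ≤ 1) →
      (∀ j, ∑ z, (W n).prob (c n j) z * g j z = (W n).kvCapacity) →
      (W n).wordProb (c n)
        {y | ε / 8 * N n ≤ |∑ j, g j (y j) - N n * (W n).kvCapacity|} ≤
      ((ε / 8) ^ 2 * (N n : ℝ))⁻¹ := by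
    intro g h0 h1 hμ
    have key := (W n).wordProb_deviation_mul_le (c n) h0 h1 hμ (by positivity : 0 ≤ ε / 8)
    rw [← one_div, le_div_iff₀ (by positivity)]
    refine le_of_mul_le_mul_right ?_ hNpos
    linarith
  have h1 := hdev (fun j z => (W n).app z (c n j)) (fun j z => (W n).app_nonneg z _)
    (fun j z => (W n).app_le_one z _) fun j => KoetterVardy.Channel.sum_prob_mul_app (hW n) _
  have h2 := hdev (fun _ z => ∑ a, (W n).app z a ^ 2)
    (fun _ z => Finset.sum_nonneg fun a _ => sq_nonneg _)
    (fun _ z => (W n).sum_app_sq_le_one z) fun j =>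
      KoetterVardy.Channel.sum_prob_mul_sum_app_sq (hW n) _
  -- Outside the two deviation events the decoding condition holds.
  have hunion := (W n).one_le_wordProb_add_add (c n)
    (E := {y | ∀ s, s₀ n ≤ s →
      KoetterVardy.Succeeds (α n) (k n) ((W n).reliability y) s (c n)})
    (E₁ := {y | ε / 8 * N n ≤
      |∑ j, (W n).app (y j) (c n j) - N n * (W n).kvCapacity|})
    (E₂ := {y | ε / 8 * N n ≤
      |∑ j, ∑ a, (W n).app (y j) a ^ 2 - N n * (W n).kvCapacity|}) (by
    intro y hy₁ hy₂
    simp only [Set.mem_ofPred_eq, not_le] at hy₁ hy₂ ⊢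
    have hkR : ((k n - 1 : ℕ) : ℝ) < R * N n := by
      have h3 := (div_le_iff₀ hNpos).mp (hrate n)
      have h4 : ((k n - 1 : ℕ) : ℝ) < k n := by
        exact_mod_cast Nat.sub_lt (hk n) one_pos
      linarith
    obtain ⟨hpos, hlt⟩ := KoetterVardy.decoding_condition hNpos (Nat.cast_nonneg _) hε hkR hR
      (by rwa [← Real.dist_eq]) hy₁ hy₂
    exact hs₀ n (c n) y (hc n) hpos hlt)
  linarith
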